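/- **Parametric Transversality Theorem.** Let $M$, $N$, $T$ be smooth manifolds (finite-dimensional, Hausdorff, second countable, without boundary) and let $S\subset N$ be an embedded smooth submanifold. A smooth map $f:X\to N$ from a smooth manifold $X$ is called transverse to $S$ if for every $x\in X$ with $f(x)\in S$ one has $T_{f(x)}S+\operatorname{im}(df_x)=T_{f(x)}N$. Let $F:M\times T\to N$ be a smooth map that is transverse to $S$. Then for almost every $t\in T$ the map $F_t:M\to N$, $x\mapsto F(x,t)$, is transverse to $S$; that is, the set of all $t\in T$ for which $F_t$ is not transverse to $S$ has measure zero in $T$, meaning that its image in every smooth chart of $T$ is a Lebesgue null set. -/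

import Mathlib

open scoped Manifold ContDiff Topology

namespace Transversality

section Transverse

variable {EM : Type*} [NormedAddCommGroup EM] [NormedSpace ℝ EM]
  {HM : Type*} [TopologicalSpace HM] (I : ModelWithCorners ℝ EM HM)
  {EN : Type*} [NormedAddCommGroup EN] [NormedSpace ℝ EN]
  {HN : Type*} [TopologicalSpace HN] (J : ModelWithCorners ℝ EN HN)
  {ES : Type*} [NormedAddCommGroup ES] [NormedSpace ℝ ES]
  {HS : Type*} [TopologicalSpace HS] (K : ModelWithCorners ℝ ES HS)
  {M : Type*} [TopologicalSpace M] [ChartedSpace HM M]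
  {N : Type*} [TopologicalSpace N] [ChartedSpace HN N]

/-- The tangent space `T_y S`, seen as a subspace of `T_y N`: the image of the differential at `y`
of the inclusion `S → N`. -/
noncomputable def tangentSubspace (S : Set N) [ChartedSpace HS S] (y : S) :
    Submodule ℝ (TangentSpace J (y : N)) :=
  (mfderiv K J (Subtype.val : S → N) y).range

/-- `f` is transverse to `S` in `x`: if `f x ∈ S`, then `T_{f x} S + im (df_x) = T_{f x} N`. -/
def IsTransverseAt (f : M → N) (S : Set N) [ChartedSpace HS S] (x : M) : Prop :=
  ∀ hx : f x ∈ S, tangentSubspace J K S ⟨f x, hx⟩ ⊔ (mfderiv I J f x).range = ⊤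

/-- `f` is transverse to `S`: it is transverse to `S` in every point. -/
def IsTransverse (f : M → N) (S : Set N) [ChartedSpace HS S] : Prop :=
  ∀ x : M, IsTransverseAt I J K f S x

end Transverse

/-- A subset `A` of a smooth `k`-manifold `T` has measure zero if in every smooth chart its image
is a Lebesgue null set of `ℝ^k`. -/
def HasMeasureZero (k : ℕ) {T : Type*} [TopologicalSpace T]
    [ChartedSpace (EuclideanSpace ℝ (Fin k)) T] (A : Set T) : Prop :=
  ∀ e ∈ IsManifold.maximalAtlas (𝓡 k) ∞ T, MeasureTheory.volume (e '' (e.source ∩ A)) = 0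

/-- The property `p` holds for almost every point of the smooth `k`-manifold `T`. -/
def ForAlmostEvery (k : ℕ) {T : Type*} [TopologicalSpace T]
    [ChartedSpace (EuclideanSpace ℝ (Fin k)) T] (p : T → Prop) : Prop :=
  HasMeasureZero k {t : T | ¬ p t}

end Transversality

/-! Near a point of `S` there is a submersion `q`, vanishing on `S`, whose differential along `S`
has kernel `TS`. Hence a map `f` is transverse to `S` at a point over `S` exactly when `q ∘ f` has
surjective differential there (`isTransverseAt_iff`).

For `G = q ∘ F` in charts, transversality of `F` makes the zero set of `G` a manifold near each bad
point `(x, t)`. If `F_t` fails to be transverse at `x`, then `(x, t)` is critical for the projection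
of this zero set to `T`, so `t` is a critical value (`measure_snd_image_eq_zero`). Sard's theorem
makes these values null, and second countability of `M × T` reduces the whole bad set to countably
many such local pieces.

Sard's theorem is proved by induction on the source dimension. Critical points with nonzero
derivative are treated by straightening one component and Fubini. Points with zero derivative where
some higher derivative is nonzero lie locally on hypersurfaces of the source. The remaining flat
points have an image of Hausdorff dimension below 1. -/

namespace Transversality

open MeasureTheory Set Module
open scoped NNReal ENNReal

/-! ### Smooth local straightening of submersions -/

section Straightening

variable {E : Type*} [NormedAddCommGroup E] [NormedSpace ℝ E] [FiniteDimensional ℝ E]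
  {G : Type*} [NormedAddCommGroup G] [NormedSpace ℝ G] [FiniteDimensional ℝ G]

/-- Smooth implicit function theorem: a smooth map with surjective derivative at `x₀` is the first
component of a smooth local chart around `x₀`. -/
theorem exists_straightening {w : E → G} {U : Set E} (hU : IsOpen U) (hw : ContDiffOn ℝ ∞ w U)
    {x₀ : E} (hx₀ : x₀ ∈ U) (hsurj : (fderiv ℝ w x₀).range = ⊤) :
    ∃ φ : OpenPartialHomeomorph E (G × (fderiv ℝ w x₀).ker), x₀ ∈ φ.source ∧ φ.source ⊆ U ∧
      (∀ x ∈ φ.source, (φ x).1 = w x) ∧ ContDiffOn ℝ ∞ φ.symm φ.target := by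
  have := FiniteDimensional.complete ℝ E
  have := FiniteDimensional.complete ℝ G
  have hw₀ : HasStrictFDerivAt w (fderiv ℝ w x₀) x₀ :=
    ((hw x₀ hx₀).contDiffAt (hU.mem_nhds hx₀)).hasStrictFDerivAt (by simp)
  set D := hw₀.implicitFunctionDataOfComplemented w _ hsurj
    (fderiv ℝ w x₀).ker_closedComplemented_of_finiteDimensional_range with hD
  have hsm : ContDiffOn ℝ ∞ D.prodFun U := by
    have h2 : ContDiff ℝ ∞ D.rightFun := by
      simp only [hD, HasStrictFDerivAt.implicitFunctionDataOfComplemented]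
      fun_prop
    exact hw.prodMk h2.contDiffOn
  have hcont : ContinuousOn (fderiv ℝ D.prodFun) U :=
    (hsm.fderiv_of_isOpen hU (m := 0) (by simp)).continuousOn
  -- Shrinking to the points with invertible derivative makes the inverse smooth on the whole
  -- target, not only at the image of `x₀`.
  have hinv : IsOpen {L : E →L[ℝ] G × (fderiv ℝ w x₀).ker | L.IsInvertible} :=
    ContinuousLinearEquiv.isOpen
  have hV := hcont.isOpen_inter_preimage hU hinv
  set φ := D.toOpenPartialHomeomorph.restrOpen _ hV with hφ
  refine ⟨φ, ⟨D.pt_mem_toOpenPartialHomeomorph_source, hx₀, ?_⟩, fun x hx ↦ hx.2.1,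
    fun x hx ↦ rfl, fun z hz ↦ ?_⟩
  · exact D.isInvertible_fderiv_prodFun
  · have hz' := φ.map_target hz
    obtain ⟨e, he⟩ := hz'.2.2
    have hd := (hsm _ hz'.2.1).contDiffAt (hU.mem_nhds hz'.2.1)
    refine (φ.contDiffAt_symm (f₀' := e) hz ?_ hd).contDiffWithinAt
    rw [he]
    exact (hd.differentiableAt (by simp)).hasFDerivAt

end Straightening

/-- Pulling back the outer measure along `f` turns this into the Lindelöf argument in `X`; neither
`f` nor `s` has to be measurable. -/
theorem measure_image_null_of_locally_null {X Y : Type*} [TopologicalSpace X]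
    [SecondCountableTopology X] [MeasurableSpace Y] (μ : Measure Y) (f : X → Y) (s : Set X)
    (h : ∀ x ∈ s, ∃ u ∈ 𝓝[s] x, μ (f '' u) = 0) : μ (f '' s) = 0 :=
  measure_null_of_locally_null (μ := OuterMeasure.comap f μ.toOuterMeasure) s h

/-! ### Images of flat points -/

section Flat

variable {E : Type*} [NormedAddCommGroup E] [NormedSpace ℝ E]
  {F : Type*} [NormedAddCommGroup F] [NormedSpace ℝ F]

/-- The points where the derivatives of `f` of order `1, …, k` vanish. -/
def flatSet (f : E → F) (k : ℕ) : Set E :=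
  {x | ∀ j, 1 ≤ j → j ≤ k → iteratedFDeriv ℝ j f x = 0}

/-- Taylor's estimate by descent on the order: each derivative vanishing at `x` gains a factor `‖y -
x‖` by the mean value inequality. -/
theorem norm_sub_le_of_mem_flatSet {f : E → F} {B : Set E} (hB : Convex ℝ B)
    (hf : ∀ x ∈ B, ContDiffAt ℝ ∞ f x) {k : ℕ} {C : ℝ}
    (hC : ∀ y ∈ B, ‖iteratedFDeriv ℝ (k + 1) f y‖ ≤ C) {x : E} (hx : x ∈ B)
    (hxk : x ∈ flatSet f k) {y : E} (hy : y ∈ B) : ‖f y - f x‖ ≤ C * ‖y - x‖ ^ (k + 1) := by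
  have hC0 : 0 ≤ C := (norm_nonneg _).trans (hC x hx)
  have key : ∀ i j, i + j = k → ∀ y ∈ B, ‖iteratedFDeriv ℝ (j + 1) f y‖ ≤ C * ‖y - x‖ ^ i := by
    intro i
    induction i with
    | zero => intro j hj y hy; obtain rfl : j = k := by omega
              simpa using hC y hy
    | succ i ih =>
      intro j hj y hy
      have hseg : segment ℝ x y ⊆ B := hB.segment_subset hx hy
      have := (convex_segment x y).norm_image_sub_le_of_norm_fderiv_le (𝕜 := ℝ)
        (f := iteratedFDeriv ℝ (j + 1) f) (C := C * ‖y - x‖ ^ i) (fun z hz ↦ ?_) (fun z hz ↦ ?_)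
        (left_mem_segment ℝ x y) (right_mem_segment ℝ x y)
      · rwa [hxk (j + 1) (by omega) (by omega), sub_zero, mul_assoc, ← pow_succ] at this
      · exact ((hf z (hseg hz)).iteratedFDeriv_right (m := 1)
          (by exact_mod_cast le_top)).differentiableAt (by simp)
      · rw [norm_fderiv_iteratedFDeriv]
        refine (ih (j + 1) (by omega) z (hseg hz)).trans ?_
        gcongr
        exact norm_sub_le_of_mem_segment hz
  have hseg : segment ℝ x y ⊆ B := hB.segment_subset hx hy
  have := (convex_segment x y).norm_image_sub_le_of_norm_fderiv_le (𝕜 := ℝ)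
    (f := f) (C := C * ‖y - x‖ ^ k) (fun z hz ↦ ?_) (fun z hz ↦ ?_)
    (left_mem_segment ℝ x y) (right_mem_segment ℝ x y)
  · rwa [mul_assoc, ← pow_succ] at this
  · exact (hf z (hseg hz)).differentiableAt (by simp)
  · rw [← norm_iteratedFDeriv_one]
    refine (key k 0 (by omega) z (hseg hz)).trans ?_
    gcongr
    exact norm_sub_le_of_mem_segment hz

/-- On the flat set `f` is locally Hölder of exponent `k + 1`, which divides Hausdorff dimension by
`k + 1`. -/
theorem dimH_image_flatSet_le [FiniteDimensional ℝ E] {f : E → F} {U : Set E} (hU : IsOpen U)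
    (hf : ContDiffOn ℝ ∞ f U) (k : ℕ) :
    dimH (f '' (U ∩ flatSet f k)) ≤ finrank ℝ E / ((k + 1 : ℕ) : ℝ≥0) := by
  have hfa : ∀ x ∈ U, ContDiffAt ℝ ∞ f x := fun x hx ↦ (hf x hx).contDiffAt (hU.mem_nhds hx)
  refine (dimH_image_le_of_locally_holder_on (r := ((k + 1 : ℕ) : ℝ≥0)) (by positivity)
    fun x hx ↦ ?_).trans ?_
  · obtain ⟨r, hr, hrU⟩ := Metric.isOpen_iff.1 hU x hx.1
    have hcont : ContinuousAt (fun y ↦ ‖iteratedFDeriv ℝ (k + 1) f y‖) x :=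
      ((hfa x hx.1).iteratedFDeriv_right (m := 0) (by exact_mod_cast le_top)).continuousAt.norm
    obtain ⟨r', hr', hb⟩ := Metric.eventually_nhds_iff_ball.1
      (hcont.eventually (eventually_le_nhds (lt_add_one _)))
    set C : ℝ≥0 := ‖iteratedFDeriv ℝ (k + 1) f x‖₊ + 1
    refine ⟨C, U ∩ flatSet f k ∩ Metric.ball x (min r r'), Filter.inter_mem self_mem_nhdsWithin
      (mem_nhdsWithin_of_mem_nhds (Metric.ball_mem_nhds x (lt_min hr hr'))), ?_⟩
    intro a ha b hb'
    have := norm_sub_le_of_mem_flatSet (f := f) (k := k) (C := C) (convex_ball x (min r r'))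
      (fun z hz ↦ hfa z (hrU (Metric.ball_subset_ball (min_le_left _ _) hz)))
      (fun z hz ↦ hb z (Metric.ball_subset_ball (min_le_right _ _) hz)) ha.2 ha.1.2 hb'.2
    rw [edist_comm, edist_comm a, edist_eq_enorm_sub, edist_eq_enorm_sub]
    have h2 : ‖f b - f a‖₊ ≤ C * ‖b - a‖₊ ^ (k + 1) := by exact_mod_cast this
    simp only [enorm_eq_nnnorm, NNReal.coe_natCast, ENNReal.rpow_natCast]
    exact_mod_cast h2
  · gcongr
    calc dimH (U ∩ flatSet f k) ≤ dimH (univ : Set E) := dimH_mono (subset_univ _)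
      _ = finrank ℝ E := Real.dimH_univ_eq_finrank E

end Flat

/-- If `R` is a right inverse of `L`, then `L'.comp R` stays invertible for `L'` near `L`. -/
theorem isOpen_setOf_range_eq_top {E F : Type*} [NormedAddCommGroup E] [NormedSpace ℝ E]
    [NormedAddCommGroup F] [NormedSpace ℝ F] [FiniteDimensional ℝ F] :
    IsOpen {L : E →L[ℝ] F | L.range = ⊤} := by
  have := FiniteDimensional.complete ℝ F
  rw [isOpen_iff_mem_nhds]
  intro L hL
  obtain ⟨R, hR⟩ := L.exists_rightInverse_of_surjective hL
  have hc : Continuous fun L' : E →L[ℝ] F ↦ L'.comp R := by fun_prop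
  have ho : IsOpen {A : F →L[ℝ] F | A.IsInvertible} := ContinuousLinearEquiv.isOpen
  refine Filter.mem_of_superset ((ho.preimage hc).mem_nhds ?_) ?_
  · exact ⟨ContinuousLinearEquiv.refl ℝ F, hR.symm⟩
  · rintro L' ⟨e, he⟩
    refine LinearMap.range_eq_top.2 fun y ↦ ⟨R (e.symm y), ?_⟩
    have := DFunLike.congr_fun he (e.symm y)
    simpa using this.symm

/-! ### Sard's theorem -/

/-- The set of critical values of every smooth map from an open subset of `E` to `F` is null. -/
def SardProperty (E F : Type*) [NormedAddCommGroup E] [NormedSpace ℝ E]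
    [NormedAddCommGroup F] [NormedSpace ℝ F] : Prop :=
  ∀ [MeasurableSpace F] [BorelSpace F] (μ : Measure F) [μ.IsAddHaarMeasure] (f : E → F)
    (U : Set E), IsOpen U → ContDiffOn ℝ ∞ f U → μ (f '' {x ∈ U | (fderiv ℝ f x).range ≠ ⊤}) = 0

section Sard

variable {E F : Type*} [NormedAddCommGroup E] [NormedSpace ℝ E]
  [NormedAddCommGroup F] [NormedSpace ℝ F]

theorem exists_dual_comp_ne_zero {L : E →L[ℝ] F} (hL : L ≠ 0) :
    ∃ ψ : F →L[ℝ] ℝ, ψ.comp L ≠ 0 := by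
  obtain ⟨v, hv⟩ : ∃ v, L v ≠ 0 := by
    by_contra! h
    exact hL (ContinuousLinearMap.ext h)
  obtain ⟨ψ, hψ⟩ := SeparatingDual.exists_ne_zero (R := ℝ) hv
  exact ⟨ψ, fun h ↦ hψ (DFunLike.congr_fun h v)⟩

theorem range_eq_top_of_dual_ne_zero {L : E →L[ℝ] ℝ} (hL : L ≠ 0) : L.range = ⊤ :=
  LinearMap.range_eq_top.2 (LinearMap.surjective (fun h ↦ hL (ContinuousLinearMap.coe_injective h)))

variable [FiniteDimensional ℝ E]

theorem finrank_ker_lt_of_dual_ne_zero {L : E →L[ℝ] ℝ} (hL : L ≠ 0) :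
    finrank ℝ L.ker < finrank ℝ E := by
  have h := LinearMap.finrank_range_add_finrank_ker (L : E →ₗ[ℝ] ℝ)
  rw [range_eq_top_of_dual_ne_zero hL, finrank_top, finrank_self] at h
  omega

variable [MeasurableSpace F] [BorelSpace F] (μ : Measure F)
  [μ.IsAddHaarMeasure] {f : E → F} {U : Set E}

/-- The points at which `f` has zero derivative and which lie on a nondegenerate part of a smooth
zero set have a null image. -/
theorem measure_image_zeroSet_eq_zero [Nontrivial F] {V : Type*} [NormedAddCommGroup V]
    [NormedSpace ℝ V] {W : E → V} (hU : IsOpen U) (hf : ContDiffOn ℝ ∞ f U)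
    (hW : ContDiffOn ℝ ∞ W U)
    (IH : ∀ K : Submodule ℝ E, finrank ℝ K < finrank ℝ E → SardProperty K F) :
    μ (f '' {x ∈ U | fderiv ℝ f x = 0 ∧ W x = 0 ∧ fderiv ℝ W x ≠ 0}) = 0 := by
  refine measure_image_null_of_locally_null μ f _ ?_
  rintro x₀ ⟨hx₀, -, -, hW₀⟩
  obtain ⟨ψ, hψ⟩ := exists_dual_comp_ne_zero hW₀
  have hw : ContDiffOn ℝ ∞ (ψ ∘ W) U := ψ.contDiff.comp_contDiffOn hW
  have hdw : fderiv ℝ (ψ ∘ W) x₀ ≠ 0 := by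
    have hd := ((hW x₀ hx₀).contDiffAt (hU.mem_nhds hx₀)).differentiableAt (by simp)
    rwa [(ψ.hasFDerivAt.comp x₀ hd.hasFDerivAt).fderiv]
  obtain ⟨φ, hφ₀, hφU, hφ1, hφs⟩ :=
    exists_straightening hU hw hx₀ (range_eq_top_of_dual_ne_zero hdw)
  have hi : Continuous fun y : (fderiv ℝ (ψ ∘ W) x₀).ker ↦ ((0 : ℝ), y) := by fun_prop
  have hV : IsOpen {y : (fderiv ℝ (ψ ∘ W) x₀).ker | ((0 : ℝ), y) ∈ φ.target} :=
    φ.open_target.preimage hi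
  have hsub : ContDiffOn ℝ ∞ (fun y : (fderiv ℝ (ψ ∘ W) x₀).ker ↦ φ.symm (0, y))
      {y | ((0 : ℝ), y) ∈ φ.target} :=
    hφs.comp (contDiff_const.prodMk contDiff_id).contDiffOn fun y hy ↦ hy
  have hh : ContDiffOn ℝ ∞ (fun y : (fderiv ℝ (ψ ∘ W) x₀).ker ↦ f (φ.symm (0, y)))
      {y | ((0 : ℝ), y) ∈ φ.target} :=
    hf.comp hsub fun y hy ↦ hφU (φ.map_target hy)
  refine ⟨_, Filter.inter_mem self_mem_nhdsWithin
    (mem_nhdsWithin_of_mem_nhds (φ.open_source.mem_nhds hφ₀)),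
    measure_mono_null ?_ (IH _ (finrank_ker_lt_of_dual_ne_zero hdw) μ _ _ hV hh)⟩
  rintro _ ⟨x, ⟨⟨hxU, hfx, hWx, -⟩, hxs⟩, rfl⟩
  have hφx : φ x = (0, (φ x).2) := Prod.ext (by simp [hφ1 x hxs, hWx]) rfl
  have hinv : φ.symm (0, (φ x).2) = x := by rw [← hφx, φ.left_inv hxs]
  have hmem : ((0 : ℝ), (φ x).2) ∈ φ.target := hφx ▸ φ.map_source hxs
  refine ⟨(φ x).2, ⟨hmem, ?_⟩, congrArg f hinv⟩
  have hd : HasFDerivAt f (0 : E →L[ℝ] F) (φ.symm (0, (φ x).2)) := by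
    rw [hinv, ← hfx]
    exact (((hf x hxU).contDiffAt (hU.mem_nhds hxU)).differentiableAt (by simp)).hasFDerivAt
  have hd2 := ((hsub _ hmem).contDiffAt (hV.mem_nhds hmem)).differentiableAt (by simp)
  have h0 := (hd.comp (φ x).2 hd2.hasFDerivAt).fderiv
  -- The restriction to the hypersurface also has zero derivative, which is not surjective because
  -- `F` is nontrivial.
  rw [ContinuousLinearMap.zero_comp] at h0
  change (fderiv ℝ (f ∘ fun y ↦ φ.symm (0, y)) (φ x).2).range ≠ ⊤
  rw [h0]
  simp [LinearMap.range_zero]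

variable [FiniteDimensional ℝ F]

/-- With `k = dim E` the dimension bound is `k / (k + 1) < 1 ≤ dim F`. -/
theorem measure_image_flatSet_eq_zero [Nontrivial F] (hU : IsOpen U) (hf : ContDiffOn ℝ ∞ f U) :
    μ (f '' (U ∩ flatSet f (finrank ℝ E))) = 0 := by
  have : (μH[finrank ℝ F] : Measure F).IsAddHaarMeasure := isAddHaarMeasure_hausdorffMeasure
  refine measure_zero_of_dimH_lt (d := finrank ℝ F) ?_
    ((dimH_image_flatSet_le hU hf _).trans_lt ?_)
  · simpa using Measure.absolutelyContinuous_isAddHaarMeasure μ μH[finrank ℝ F]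
  · have h1 : 1 ≤ finrank ℝ F := finrank_pos
    calc ((finrank ℝ E : ℕ) : ℝ≥0∞) / (((finrank ℝ E + 1 : ℕ) : ℝ≥0) : ℝ≥0∞) < 1 := by
          rw [ENNReal.div_lt_iff (by simp) (by simp)]
          simp only [ENNReal.coe_natCast, one_mul]
          exact_mod_cast Nat.lt_succ_self _
      _ ≤ _ := by exact_mod_cast h1

/-- The critical points of `f` with nonzero derivative have a null image. -/
theorem measure_image_critical_eq_zero (hU : IsOpen U) (hf : ContDiffOn ℝ ∞ f U)
    (IH : ∀ (K : Submodule ℝ E) (L : Submodule ℝ F), finrank ℝ K < finrank ℝ E →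
      SardProperty K L) :
    μ (f '' {x ∈ U | (fderiv ℝ f x).range ≠ ⊤ ∧ fderiv ℝ f x ≠ 0}) = 0 := by
  have hfa : ∀ x ∈ U, ContDiffAt ℝ ∞ f x := fun x hx ↦ (hf x hx).contDiffAt (hU.mem_nhds hx)
  refine measure_image_null_of_locally_null μ f _ ?_
  rintro x₀ ⟨hx₀, -, hne⟩
  obtain ⟨l, hl⟩ := exists_dual_comp_ne_zero hne
  obtain ⟨v, hv⟩ : ∃ v, l v = 1 := LinearMap.range_eq_top.1
    (range_eq_top_of_dual_ne_zero (L := l) (by rintro rfl; simp at hl)) 1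
  have hw : ContDiffOn ℝ ∞ (l ∘ f) U := l.contDiff.comp_contDiffOn hf
  have hdw : fderiv ℝ (l ∘ f) x₀ ≠ 0 := by
    have hd := (hfa x₀ hx₀).differentiableAt (by simp)
    rwa [(l.hasFDerivAt.comp x₀ hd.hasFDerivAt).fderiv]
  obtain ⟨φ, hφ₀, hφU, hφ1, hφs⟩ :=
    exists_straightening hU hw hx₀ (range_eq_top_of_dual_ne_zero hdw)
  set e : F ≃L[ℝ] ℝ × l.ker := ContinuousLinearEquiv.equivOfRightInverse l
    (ContinuousLinearMap.toSpanSingleton ℝ v) (fun t ↦ by simp [hv])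
  have he1 : ∀ y, (e y).1 = l y := ContinuousLinearEquiv.fst_equivOfRightInverse _ _ _
  -- Compactness makes the image of the critical points measurable, as Fubini requires.
  obtain ⟨B, hB, hxB, hBs⟩ := exists_compact_subset φ.open_source hφ₀
  have hu : IsCompact (B ∩ {x | (fderiv ℝ f x).range ≠ ⊤}) := by
    have hc : ContinuousOn (fderiv ℝ f) B :=
      (hf.fderiv_of_isOpen hU (m := 0) (by simp)).continuousOn.mono (hBs.trans hφU)
    exact hB.of_isClosed_subset
      (hc.preimage_isClosed_of_isClosed hB.isClosed isOpen_setOf_range_eq_top.isClosed_compl)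
      inter_subset_left
  refine ⟨B ∩ {x | (fderiv ℝ f x).range ≠ ⊤}, ?_, ?_⟩
  · filter_upwards [self_mem_nhdsWithin,
      mem_nhdsWithin_of_mem_nhds (mem_interior_iff_mem_nhds.1 hxB)]
      with x hx hxB using ⟨hxB, hx.2.1⟩
  have hcpt : IsCompact (e '' (f '' (B ∩ {x | (fderiv ℝ f x).range ≠ ⊤}))) :=
    (hu.image_of_continuousOn (hf.continuousOn.mono
      (inter_subset_left.trans (hBs.trans hφU)))).image e.continuous
  have hμ : (μ.map e) (e '' (f '' (B ∩ {x | (fderiv ℝ f x).range ≠ ⊤}))) = 0 := by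
    have := e.isAddHaarMeasure_map μ
    refine Measure.absolutelyContinuous_isAddHaarMeasure (μ.map e)
      ((volume : Measure ℝ).prod (Measure.addHaar : Measure l.ker)) ?_
    rw [Measure.measure_prod_null hcpt.measurableSet]
    refine Filter.Eventually.of_forall fun t ↦ ?_
    have hV : IsOpen {y : (fderiv ℝ (l ∘ f) x₀).ker | (t, y) ∈ φ.target} :=
      φ.open_target.preimage (by fun_prop)
    have hg : ContDiffOn ℝ ∞ (fun y : (fderiv ℝ (l ∘ f) x₀).ker ↦ (e (f (φ.symm (t, y)))).2)
        {y | (t, y) ∈ φ.target} := by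
      refine contDiff_snd.comp_contDiffOn (e.contDiff.comp_contDiffOn (hf.comp
        (hφs.comp (contDiff_const.prodMk contDiff_id).contDiffOn fun y hy ↦ hy) fun y hy ↦ ?_))
      exact hφU (φ.map_target hy)
    refine measure_mono_null ?_
      (IH _ l.ker (finrank_ker_lt_of_dual_ne_zero hdw) Measure.addHaar _ _ hV hg)
    rintro z ⟨_, ⟨x, ⟨hxB, hxc⟩, rfl⟩, hxz⟩
    have hxs := hBs hxB
    have hφx : φ x = (t, (φ x).2) :=
      Prod.ext (by rw [hφ1 x hxs, Function.comp, ← he1, hxz]) rfl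
    set y := (φ x).2
    have hinv : φ.symm (t, y) = x := by rw [← hφx, φ.left_inv hxs]
    have hmem : (t, y) ∈ φ.target := hφx ▸ φ.map_source hxs
    refine ⟨y, ⟨hmem, fun hsurj ↦ hxc ?_⟩, by simp only [hinv, hxz]⟩
    have hs : HasFDerivAt φ.symm (fderiv ℝ φ.symm (t, y)) (t, y) :=
      (((hφs _ hmem).contDiffAt (φ.open_target.mem_nhds hmem)).differentiableAt
        (by simp)).hasFDerivAt
    have hfd : HasFDerivAt f (fderiv ℝ f x) (φ.symm (t, y)) := by
      rw [hinv]
      exact ((hfa x (hφU hxs)).differentiableAt (by simp)).hasFDerivAt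
    set A := fderiv ℝ φ.symm (t, y)
    have hH := (e.hasFDerivAt.comp (t, y) (hfd.comp (t, y) hs))
    set H' := (e : F →L[ℝ] ℝ × l.ker).comp ((fderiv ℝ f x).comp A)
    -- In these coordinates `f` preserves the first coordinate, so `H'` is block triangular with
    -- identity corner: a surjective slice derivative would make `H'` surjective.
    have hH1 : ∀ p, (H' p).1 = p.1 := by
      have h1 : HasFDerivAt (Prod.fst : ℝ × (fderiv ℝ (l ∘ f) x₀).ker → ℝ)
          ((ContinuousLinearMap.fst ℝ ℝ l.ker).comp H') (t, y) := by
        refine ((ContinuousLinearMap.fst ℝ ℝ l.ker).hasFDerivAt.comp (t, y) hH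
          ).congr_of_eventuallyEq ?_
        filter_upwards [φ.open_target.mem_nhds hmem] with p hp
        have := hφ1 _ (φ.map_target hp)
        rw [φ.right_inv hp] at this
        simp [this, he1]
      intro p
      exact DFunLike.congr_fun (h1.unique hasFDerivAt_fst) p
    have hH2 : ∀ b, fderiv ℝ (fun y ↦ (e (f (φ.symm (t, y)))).2) y b = (H' (0, b)).2 := by
      intro b
      have h2 := ((ContinuousLinearMap.snd ℝ ℝ l.ker).hasFDerivAt.comp (t, y) hH).comp y
        (hasFDerivAt_prodMk_right t y)
      exact DFunLike.congr_fun h2.fderiv b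
    refine LinearMap.range_eq_top.2 fun c ↦ ?_
    obtain ⟨b, hb⟩ := LinearMap.range_eq_top.1 hsurj ((e c).2 - (H' ((e c).1, 0)).2)
    have hb' : (H' (0, b)).2 = (e c).2 - (H' ((e c).1, 0)).2 := (hH2 b).symm.trans hb
    refine ⟨A ((e c).1, b), e.injective ?_⟩
    change H' ((e c).1, b) = e c
    refine Prod.ext (hH1 _) ?_
    have : ((e c).1, b) = ((e c).1, 0) + (0, b) := by simp
    rw [this, map_add, Prod.snd_add, hb']
    abel
  have := e.toHomeomorph.toMeasurableEquiv.map_apply (μ := μ)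
    (e '' (f '' (B ∩ {x | (fderiv ℝ f x).range ≠ ⊤})))
  change (μ.map e) _ = μ (e ⁻¹' _) at this
  rwa [hμ, preimage_image_eq _ e.injective, eq_comm] at this

end Sard

theorem sardProperty_of_finrank_eq (n : ℕ) : ∀ (E F : Type*)
    [NormedAddCommGroup E] [NormedSpace ℝ E] [FiniteDimensional ℝ E]
    [NormedAddCommGroup F] [NormedSpace ℝ F] [FiniteDimensional ℝ F],
    finrank ℝ E = n → SardProperty E F := by
  induction n using Nat.strong_induction_on with
  | _ n ih =>
  intro E F _ _ _ _ _ _ hn _ _ μ _ f U hU hf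
  rcases subsingleton_or_nontrivial F with hF | hF
  · have : {x ∈ U | (fderiv ℝ f x).range ≠ ⊤} = ∅ :=
      eq_empty_of_forall_notMem fun x hx ↦ hx.2 (Subsingleton.elim _ _)
    simp [this]
  have h1 := measure_image_critical_eq_zero μ hU hf fun K L hK ↦ ih _ (hn ▸ hK) K L rfl
  have h2 : ∀ i, μ (f '' {x ∈ U | fderiv ℝ f x = 0 ∧ iteratedFDeriv ℝ i f x = 0 ∧
      fderiv ℝ (iteratedFDeriv ℝ i f) x ≠ 0}) = 0 := fun i ↦
    measure_image_zeroSet_eq_zero μ hU hf (fun x hx ↦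
      (((hf x hx).contDiffAt (hU.mem_nhds hx)).iteratedFDeriv_right
        (by exact_mod_cast le_top)).contDiffWithinAt)
      fun K hK ↦ ih _ (hn ▸ hK) K F rfl
  have h3 := measure_image_flatSet_eq_zero μ hU hf
  refine measure_mono_null ?_ (measure_union_null h1
    (measure_union_null (measure_iUnion_null h2) h3))
  rw [← image_iUnion, ← image_union, ← image_union]
  refine image_mono ?_
  rintro x ⟨hxU, hx⟩
  by_cases hd : fderiv ℝ f x = 0
  swap; · exact Or.inl ⟨hxU, hx, hd⟩
  refine Or.inr ?_
  by_contra hcon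
  simp only [mem_union, mem_iUnion, not_or, not_exists] at hcon
  refine hcon.2 ⟨hxU, fun j hj _ ↦ ?_⟩
  -- Outside the sets of `h2`, vanishing of the `j`-th derivative at `x` forces vanishing of the
  -- next one.
  induction j, hj using Nat.le_induction with
  | base => rw [← norm_eq_zero, norm_iteratedFDeriv_one, hd, norm_zero]
  | succ j hj IH =>
    by_contra hne
    refine hcon.1 j ⟨hxU, hd, IH (by omega), ?_⟩
    refine fun h0 ↦ hne (ContinuousMultilinearMap.ext fun v ↦ ?_)
    rw [iteratedFDeriv_succ_apply_left, h0]
    rfl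

/-- **Sard's theorem** for smooth maps between finite-dimensional spaces. -/
theorem sardProperty (E F : Type*)
    [NormedAddCommGroup E] [NormedSpace ℝ E] [FiniteDimensional ℝ E]
    [NormedAddCommGroup F] [NormedSpace ℝ F] [FiniteDimensional ℝ F] : SardProperty E F :=
  sardProperty_of_finrank_eq _ E F rfl

/-! ### The linear model of parametric transversality -/

/-- Parametric transversality to a point, in finite-dimensional spaces. -/
theorem measure_snd_image_eq_zero {P Q C : Type*}
    [NormedAddCommGroup P] [NormedSpace ℝ P] [FiniteDimensional ℝ P]
    [NormedAddCommGroup Q] [NormedSpace ℝ Q] [FiniteDimensional ℝ Q]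
    [NormedAddCommGroup C] [NormedSpace ℝ C] [FiniteDimensional ℝ C]
    [MeasurableSpace Q] [BorelSpace Q] (μ : Measure Q) [μ.IsAddHaarMeasure]
    {G : P × Q → C} {O A : Set (P × Q)} (hO : IsOpen O) (hG : ContDiffOn ℝ ∞ G O) (hA : A ⊆ O)
    (h0 : ∀ p ∈ A, G p = 0) (hs : ∀ p ∈ A, (fderiv ℝ G p).range = ⊤)
    (hn : ∀ p ∈ A, (fderiv ℝ (fun u ↦ G (u, p.2)) p.1).range ≠ ⊤) :
    μ (Prod.snd '' A) = 0 := by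
  refine measure_image_null_of_locally_null μ _ _ fun p₀ hp₀ ↦ ?_
  obtain ⟨φ, hφ₀, hφO, hφ1, hφs⟩ := exists_straightening hO hG (hA hp₀) (hs p₀ hp₀)
  have hV : IsOpen {z : (fderiv ℝ G p₀).ker | ((0 : C), z) ∈ φ.target} :=
    φ.open_target.preimage (by fun_prop)
  have hh : ContDiffOn ℝ ∞ (fun z : (fderiv ℝ G p₀).ker ↦ (φ.symm (0, z)).2)
      {z | ((0 : C), z) ∈ φ.target} :=
    contDiff_snd.comp_contDiffOn
      (hφs.comp (contDiff_const.prodMk contDiff_id).contDiffOn fun y hy ↦ hy)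
  refine ⟨_, Filter.inter_mem self_mem_nhdsWithin
    (mem_nhdsWithin_of_mem_nhds (φ.open_source.mem_nhds hφ₀)),
    measure_mono_null ?_ (sardProperty _ Q μ _ _ hV hh)⟩
  rintro _ ⟨p, ⟨hpA, hps⟩, rfl⟩
  have hφp : φ p = (0, (φ p).2) := Prod.ext (by rw [hφ1 p hps, h0 p hpA]) rfl
  set z := (φ p).2
  have hinv : φ.symm (0, z) = p := by rw [← hφp, φ.left_inv hps]
  have hmem : (0, z) ∈ φ.target := hφp ▸ φ.map_source hps
  refine ⟨z, ⟨hmem, fun hsurj ↦ hn p hpA ?_⟩, congrArg Prod.snd hinv⟩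
  have hsd : HasFDerivAt φ.symm (fderiv ℝ φ.symm (0, z)) (0, z) :=
    (((hφs _ hmem).contDiffAt (φ.open_target.mem_nhds hmem)).differentiableAt
      (by simp)).hasFDerivAt
  have hGd : HasFDerivAt G (fderiv ℝ G p) p :=
    (((hG p (hA hpA)).contDiffAt (hO.mem_nhds (hA hpA))).differentiableAt (by simp)).hasFDerivAt
  set B := fderiv ℝ φ.symm (0, z)
  have hGB : ∀ c, fderiv ℝ G p (B c) = c.1 := by
    have h1 : HasFDerivAt (Prod.fst : C × (fderiv ℝ G p₀).ker → C) ((fderiv ℝ G p).comp B)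
        (0, z) := by
      rw [← hinv] at hGd
      have := hGd.comp (0, z) hsd
      rw [hinv] at this
      refine this.congr_of_eventuallyEq ?_
      filter_upwards [φ.open_target.mem_nhds hmem] with c hc
      have := hφ1 _ (φ.map_target hc)
      rwa [φ.right_inv hc] at this
    intro c
    exact DFunLike.congr_fun (h1.unique hasFDerivAt_fst) c
  have hB : ∀ ζ, fderiv ℝ (fun z ↦ (φ.symm (0, z)).2) z ζ = (B (0, ζ)).2 := by
    intro ζ
    have h2 := ((ContinuousLinearMap.snd ℝ P Q).hasFDerivAt.comp (0, z) hsd).comp z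
      (hasFDerivAt_prodMk_right 0 z)
    exact DFunLike.congr_fun h2.fderiv ζ
  -- Lift `c` to `(a, b)` and subtract the vector `B (0, ζ)`, tangent to the level set and with
  -- second component `b`; the result is a vector along `P` with the same image `c`.
  refine LinearMap.range_eq_top.2 fun c ↦ ?_
  obtain ⟨⟨a, b⟩, hab⟩ := LinearMap.range_eq_top.1 (hs p hpA) c
  obtain ⟨ζ, hζ⟩ := LinearMap.range_eq_top.1 hsurj b
  have hζ' : (B (0, ζ)).2 = b := (hB ζ).symm.trans hζ
  refine ⟨a - (B (0, ζ)).1, ?_⟩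
  have hpart : fderiv ℝ (fun u ↦ G (u, p.2)) p.1 =
      (fderiv ℝ G p).comp (ContinuousLinearMap.inl ℝ P Q) :=
    (HasFDerivAt.comp p.1 (f := fun u ↦ (u, p.2)) hGd (hasFDerivAt_prodMk_left p.1 p.2)).fderiv
  have hsplit : ((a - (B (0, ζ)).1, 0) : P × Q) = (a, b) - B (0, ζ) :=
    Prod.ext rfl (by simp [hζ'])
  change fderiv ℝ (fun u ↦ G (u, p.2)) p.1 _ = c
  change fderiv ℝ G p (a, b) = c at hab
  rw [hpart, ContinuousLinearMap.comp_apply, ContinuousLinearMap.inl_apply, hsplit, map_sub, hGB,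
    hab, sub_zero]

theorem range_comp_eq_top_iff {V₁ V₂ V₃ : Type*} [AddCommGroup V₁] [Module ℝ V₁]
    [AddCommGroup V₂] [Module ℝ V₂] [AddCommGroup V₃] [Module ℝ V₃] {D : V₂ →ₗ[ℝ] V₃}
    (hD : D.range = ⊤) (L : V₁ →ₗ[ℝ] V₂) : (D ∘ₗ L).range = ⊤ ↔ D.ker ⊔ L.range = ⊤ := by
  rw [LinearMap.range_comp]
  constructor <;> intro h
  · rw [sup_comm, ← Submodule.comap_map_eq, h, Submodule.comap_top]
  · have := congrArg (Submodule.map D) h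
    rwa [Submodule.map_sup, Submodule.map_top, hD, (LinearMap.le_ker_iff_map).1 le_rfl,
      bot_sup_eq] at this

/-! ### Submanifolds and transversality in charts -/

section Manifold

theorem mdifferentiable_of_mem_maximalAtlas {n : ℕ} {N : Type*} [TopologicalSpace N]
    [ChartedSpace (EuclideanSpace ℝ (Fin n)) N] [IsManifold (𝓡 n) ∞ N]
    {e : OpenPartialHomeomorph N (EuclideanSpace ℝ (Fin n))}
    (he : e ∈ IsManifold.maximalAtlas (𝓡 n) ∞ N) : e.MDifferentiable (𝓡 n) (𝓡 n) :=
  ⟨(contMDiffOn_of_mem_maximalAtlas he).mdifferentiableOn (by simp),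
    (contMDiffOn_symm_of_mem_maximalAtlas he).mdifferentiableOn (by simp)⟩

/-- An embedded submanifold is locally contained in a level set of a submersion whose differential
has the tangent space as kernel. -/
theorem exists_local_defining_map {n d : ℕ} {N : Type*} [TopologicalSpace N]
    [ChartedSpace (EuclideanSpace ℝ (Fin n)) N] [IsManifold (𝓡 n) ∞ N]
    {S : Set N} [ChartedSpace (EuclideanSpace ℝ (Fin d)) S] [IsManifold (𝓡 d) ∞ S]
    (hS : Manifold.IsSmoothEmbedding (𝓡 d) (𝓡 n) ∞ (Subtype.val : S → N)) (y₀ : S) :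
    ∃ (C : Type) (_ : NormedAddCommGroup C) (_ : NormedSpace ℝ C) (_ : FiniteDimensional ℝ C)
      (W : Set N) (q : N → C), IsOpen W ∧ (y₀ : N) ∈ W ∧ ContMDiffOn (𝓡 n) 𝓘(ℝ, C) ∞ q W ∧
      ∀ y : S, (y : N) ∈ W → q y = 0 ∧ (mfderiv (𝓡 n) 𝓘(ℝ, C) q y).range = ⊤ ∧
        (mfderiv (𝓡 n) 𝓘(ℝ, C) q y).ker = tangentSubspace (𝓡 n) (𝓡 d) S y := by
  obtain ⟨C, _, _, hC⟩ := hS.isImmersion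
  have h := hC y₀
  have hCfin : FiniteDimensional ℝ C := by
    let ι : C →ₗ[ℝ] EuclideanSpace ℝ (Fin n) :=
      h.equiv.toLinearEquiv.toLinearMap ∘ₗ LinearMap.inr ℝ (EuclideanSpace ℝ (Fin d)) C
    refine FiniteDimensional.of_injective ι ?_
    exact h.equiv.injective.comp (Prod.mk_right_injective 0)
  set φ := h.domChart
  set ψ := h.codChart
  set ε := h.equiv
  have hψ := mdifferentiable_of_mem_maximalAtlas h.codChart_mem_maximalAtlas
  have hφ := mdifferentiable_of_mem_maximalAtlas h.domChart_mem_maximalAtlas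
  -- `S` carries the subspace topology, so `W` can be chosen to meet `S` only in the domain of the
  -- slice chart.
  obtain ⟨W, hW, hWφ⟩ := isOpen_induced_iff.1 φ.open_source
  have hmaps : ∀ y : S, y ∈ φ.source → (y : N) ∈ ψ.source := h.source_subset_preimage_source
  have hwrit : ∀ z ∈ φ.target, ψ (φ.symm z : N) = ε (z, 0) := fun z hz ↦ by
    have hz' : z ∈ (φ.extend (𝓡 d)).target := by simpa using hz
    simpa using h.writtenInCharts hz'
  let pr : EuclideanSpace ℝ (Fin n) →L[ℝ] C :=
    (ContinuousLinearMap.snd ℝ (EuclideanSpace ℝ (Fin d)) C).comp ε.symm.toContinuousLinearMap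
  have hprsm : ContMDiff (𝓡 n) 𝓘(ℝ, C) ∞ pr := pr.contDiff.contMDiff
  have hprd : ∀ z, MDifferentiableAt (𝓡 n) 𝓘(ℝ, C) pr z := fun z ↦
    (hprsm z).mdifferentiableAt (by simp)
  refine ⟨C, inferInstance, inferInstance, hCfin, W ∩ ψ.source, pr ∘ ψ,
    hW.inter ψ.open_source, ⟨?_, h.mem_codChart_source⟩,
    hprsm.comp_contMDiffOn
      ((contMDiffOn_of_mem_maximalAtlas h.codChart_mem_maximalAtlas).mono inter_subset_right), ?_⟩
  · have : y₀ ∈ Subtype.val ⁻¹' W := hWφ ▸ h.mem_domChart_source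
    exact this
  suffices key : ∀ z ∈ φ.target, (pr ∘ ψ) (φ.symm z : N) = 0 ∧
      (mfderiv (𝓡 n) 𝓘(ℝ, C) (pr ∘ ψ) (φ.symm z : N)).range = ⊤ ∧
      (mfderiv (𝓡 n) 𝓘(ℝ, C) (pr ∘ ψ) (φ.symm z : N)).ker =
        tangentSubspace (𝓡 n) (𝓡 d) S (φ.symm z) by
    intro y hy
    have hyφ : y ∈ φ.source := hWφ ▸ hy.1
    have := key (φ y) (φ.map_source hyφ)
    rwa [φ.left_inv hyφ] at this
  intro z hz
  set y := φ.symm z with hy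
  have hyφ : y ∈ φ.source := φ.map_target hz
  have hyψ := hmaps y hyφ
  have hψd : MDifferentiableAt (𝓡 n) (𝓡 n) ψ (y : N) := hψ.mdifferentiableAt hyψ
  have hvd : MDifferentiableAt (𝓡 d) (𝓡 n) (Subtype.val : S → N) y :=
    (hS.contMDiff y).mdifferentiableAt (by simp)
  have hφd : MDifferentiableAt (𝓡 d) (𝓡 d) φ.symm z := hφ.mdifferentiableAt_symm hz
  have hq : mfderiv (𝓡 n) 𝓘(ℝ, C) (pr ∘ ψ) (y : N) = pr.comp (mfderiv (𝓡 n) (𝓡 n) ψ (y : N)) := by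
    rw [mfderiv_comp (y : N) (hprd _) hψd, mfderiv_eq_fderiv, pr.fderiv]
    rfl
  have hinc : ∀ b, mfderiv (𝓡 n) (𝓡 n) ψ (y : N) (mfderiv (𝓡 d) (𝓡 n) (Subtype.val : S → N) y
      (mfderiv (𝓡 d) (𝓡 d) φ.symm z b)) = ε (b, 0) := by
    intro b
    have h1 : mfderiv (𝓡 d) (𝓡 n) (ψ ∘ Subtype.val ∘ φ.symm) z =
        ε.toContinuousLinearMap.comp (ContinuousLinearMap.inl ℝ _ C) := by
      have : ψ ∘ Subtype.val ∘ φ.symm =ᶠ[𝓝 z]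
          ε.toContinuousLinearMap.comp (ContinuousLinearMap.inl ℝ _ C) := by
        filter_upwards [φ.open_target.mem_nhds hz] with z' hz' using hwrit z' hz'
      rw [this.mfderiv_eq, mfderiv_eq_fderiv, ContinuousLinearMap.fderiv]
    have h2 := DFunLike.congr_fun (mfderiv_comp z hψd (hvd.comp z hφd)) b
    have h3 := DFunLike.congr_fun (mfderiv_comp z hvd hφd) b
    exact (congrArg (mfderiv (𝓡 n) (𝓡 n) ψ (y : N)) h3.symm).trans
      (h2.symm.trans (DFunLike.congr_fun h1 b))
  refine ⟨?_, ?_, ?_⟩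
  · simp [pr, hy, hwrit z hz]
  · rw [hq]
    refine LinearMap.range_eq_top.2 fun c ↦ ?_
    obtain ⟨v, hv⟩ := hψ.mfderiv_surjective hyψ (ε (0, c))
    refine ⟨v, ?_⟩
    change pr (mfderiv (𝓡 n) (𝓡 n) ψ (y : N) v) = c
    rw [hv]
    exact congrArg Prod.snd (ε.symm_apply_apply (0, c))
  · rw [hq]
    refine le_antisymm (fun v hv ↦ ?_) ?_
    · replace hv : (ε.symm (mfderiv (𝓡 n) (𝓡 n) ψ (y : N) v)).2 = 0 := hv
      refine ⟨mfderiv (𝓡 d) (𝓡 d) φ.symm z (ε.symm (mfderiv (𝓡 n) (𝓡 n) ψ (y : N) v)).1,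
        hψ.mfderiv_injective hyψ ((hinc _).trans ?_)⟩
      rw [← hv]
      exact ε.apply_symm_apply _
    · rintro _ ⟨w, rfl⟩
      obtain ⟨b, rfl⟩ := hφ.symm.mfderiv_surjective (x := z) hz w
      change (ε.symm (mfderiv (𝓡 n) (𝓡 n) ψ (y : N) (mfderiv (𝓡 d) (𝓡 n) (Subtype.val : S → N) y
        (mfderiv (𝓡 d) (𝓡 d) φ.symm z b)))).2 = 0
      rw [hinc b]
      simp

/-- A one-sided inverse suffices: one direction is the chain rule for `g ∘ Ψ`, the other for `g = (g
∘ Ψ) ∘ Θ` near `x`. -/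
theorem range_mfderiv_eq_top_iff {E : Type*} [NormedAddCommGroup E] [NormedSpace ℝ E]
    {C : Type*} [NormedAddCommGroup C] [NormedSpace ℝ C]
    {EX : Type*} [NormedAddCommGroup EX] [NormedSpace ℝ EX] {HX : Type*} [TopologicalSpace HX]
    {I : ModelWithCorners ℝ EX HX} {X : Type*} [TopologicalSpace X] [ChartedSpace HX X]
    {Ψ : E → X} {Θ : X → E} {x : X} (hΨ : MDifferentiableAt 𝓘(ℝ, E) I Ψ (Θ x))
    (hΘ : MDifferentiableAt I 𝓘(ℝ, E) Θ x) (hinv : ∀ᶠ x' in 𝓝 x, Ψ (Θ x') = x')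
    {g : X → C} (hg : MDifferentiableAt I 𝓘(ℝ, C) g x) :
    (fderiv ℝ (g ∘ Ψ) (Θ x)).range = ⊤ ↔ (mfderiv I 𝓘(ℝ, C) g x).range = ⊤ := by
  have hx : Ψ (Θ x) = x := hinv.self_of_nhds
  have hgΨ : MDifferentiableAt 𝓘(ℝ, E) 𝓘(ℝ, C) (g ∘ Ψ) (Θ x) :=
    MDifferentiableAt.comp (Θ x) (hx.symm ▸ hg) hΨ
  have h1 : mfderiv I 𝓘(ℝ, C) g x =
      (mfderiv 𝓘(ℝ, E) 𝓘(ℝ, C) (g ∘ Ψ) (Θ x)).comp (mfderiv I 𝓘(ℝ, E) Θ x) := by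
    rw [← mfderiv_comp x hgΨ hΘ]
    refine Filter.EventuallyEq.mfderiv_eq ?_
    filter_upwards [hinv] with x' hx'
    simp [hx']
  rw [← mfderiv_eq_fderiv]
  refine ⟨fun h ↦ ?_, fun h ↦ ?_⟩
  · have h2 := mfderiv_comp_of_eq hg hΨ hx
    suffices h3 : (mfderiv I 𝓘(ℝ, C) g (Ψ (Θ x))).range = ⊤ by rwa [hx] at h3
    refine LinearMap.range_eq_top.2 fun c ↦ ?_
    obtain ⟨v, hv⟩ := LinearMap.range_eq_top.1 h c
    exact ⟨mfderiv 𝓘(ℝ, E) I Ψ (Θ x) v, (DFunLike.congr_fun h2 v).symm.trans hv⟩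
  · refine LinearMap.range_eq_top.2 fun c ↦ ?_
    obtain ⟨v, hv⟩ := LinearMap.range_eq_top.1 h c
    exact ⟨mfderiv I 𝓘(ℝ, E) Θ x v, (DFunLike.congr_fun h1 v).symm.trans hv⟩

theorem isTransverseAt_iff {EX : Type*} [NormedAddCommGroup EX] [NormedSpace ℝ EX] {HX : Type*}
    [TopologicalSpace HX] {I : ModelWithCorners ℝ EX HX} {X : Type*} [TopologicalSpace X]
    [ChartedSpace HX X] {n d : ℕ} {N : Type*} [TopologicalSpace N]
    [ChartedSpace (EuclideanSpace ℝ (Fin n)) N]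
    {S : Set N} [ChartedSpace (EuclideanSpace ℝ (Fin d)) S]
    {C : Type*} [NormedAddCommGroup C] [NormedSpace ℝ C] {q : N → C} {f : X → N} {x : X}
    (hf : MDifferentiableAt I (𝓡 n) f x) (hx : f x ∈ S)
    (hq : MDifferentiableAt (𝓡 n) 𝓘(ℝ, C) q (f x))
    (hr : (mfderiv (𝓡 n) 𝓘(ℝ, C) q (f x)).range = ⊤)
    (hk : (mfderiv (𝓡 n) 𝓘(ℝ, C) q (f x)).ker = tangentSubspace (𝓡 n) (𝓡 d) S ⟨f x, hx⟩) :
    IsTransverseAt I (𝓡 n) (𝓡 d) f S x ↔ (mfderiv I 𝓘(ℝ, C) (q ∘ f) x).range = ⊤ := by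
  have key := range_comp_eq_top_iff hr (mfderiv I (𝓡 n) f x).toLinearMap
  rw [hk] at key
  rw [mfderiv_comp x hq hf]
  exact ⟨fun h ↦ key.2 (h hx), fun h _ ↦ key.1 h⟩

end Manifold

end Transversality

/-! ### Globalization -/

open Transversality Set MeasureTheory in
theorem mainTheorem2 {m n k d : ℕ}
    {M : Type*} [TopologicalSpace M] [T2Space M] [SecondCountableTopology M]
    [ChartedSpace (EuclideanSpace ℝ (Fin m)) M] [IsManifold (𝓡 m) ∞ M]
    {N : Type*} [TopologicalSpace N] [T2Space N] [SecondCountableTopology N]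
    [ChartedSpace (EuclideanSpace ℝ (Fin n)) N] [IsManifold (𝓡 n) ∞ N]
    {T : Type*} [TopologicalSpace T] [T2Space T] [SecondCountableTopology T]
    [ChartedSpace (EuclideanSpace ℝ (Fin k)) T] [IsManifold (𝓡 k) ∞ T]
    -- `S` is an embedded smooth submanifold of `N` of dimension `d`
    (S : Set N) [ChartedSpace (EuclideanSpace ℝ (Fin d)) S] [IsManifold (𝓡 d) ∞ S]
    (hS : Manifold.IsSmoothEmbedding (𝓡 d) (𝓡 n) ∞ (Subtype.val : S → N))
    (F : M × T → N) (hF : ContMDiff ((𝓡 m).prod (𝓡 k)) (𝓡 n) ∞ F)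
    (hFS : Transversality.IsTransverse ((𝓡 m).prod (𝓡 k)) (𝓡 n) (𝓡 d) F S) :
    Transversality.ForAlmostEvery k
      (fun t : T => Transversality.IsTransverse (𝓡 m) (𝓡 n) (𝓡 d) (fun x : M => F (x, t)) S) := by
  intro e he
  -- Bad pairs are kept in `M × T`: each bad parameter may have many bad points, and the
  -- localization is around pairs.
  set A : Set (M × T) := {p | p.2 ∈ e.source ∧
    ¬ IsTransverseAt (𝓡 m) (𝓡 n) (𝓡 d) (fun x ↦ F (x, p.2)) S p.1}
  suffices h : volume ((fun p : M × T ↦ e p.2) '' A) = 0 by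
    refine measure_mono_null ?_ h
    rintro _ ⟨t, ⟨hte, ht⟩, rfl⟩
    obtain ⟨x, hx⟩ := not_forall.1 ht
    exact ⟨(x, t), ⟨hte, hx⟩, rfl⟩
  refine measure_image_null_of_locally_null volume _ A fun p₀ hp₀ ↦ ?_
  obtain ⟨hy₀, -⟩ := not_forall.1 hp₀.2
  obtain ⟨C, _, _, _, W, q, hW, hyW, hq, hqS⟩ := exists_local_defining_map hS ⟨F p₀, hy₀⟩
  set a := chartAt (EuclideanSpace ℝ (Fin m)) p₀.1
  have ha : a ∈ IsManifold.maximalAtlas (𝓡 m) ∞ M := IsManifold.chart_mem_maximalAtlas p₀.1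
  let Ψ : EuclideanSpace ℝ (Fin m) × EuclideanSpace ℝ (Fin k) → M × T :=
    fun z ↦ (a.symm z.1, e.symm z.2)
  let Θ : M × T → EuclideanSpace ℝ (Fin m) × EuclideanSpace ℝ (Fin k) :=
    fun p ↦ (a p.1, e p.2)
  have hΨ : ContMDiffOn 𝓘(ℝ, EuclideanSpace ℝ (Fin m) × EuclideanSpace ℝ (Fin k))
      ((𝓡 m).prod (𝓡 k)) ∞ Ψ (a.target ×ˢ e.target) :=
    ((contMDiffOn_symm_of_mem_maximalAtlas ha).comp contDiff_fst.contMDiff.contMDiffOn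
      fun z hz ↦ hz.1).prodMk
    ((contMDiffOn_symm_of_mem_maximalAtlas he).comp contDiff_snd.contMDiff.contMDiffOn
      fun z hz ↦ hz.2)
  have hΘ : ContMDiffOn ((𝓡 m).prod (𝓡 k))
      𝓘(ℝ, EuclideanSpace ℝ (Fin m) × EuclideanSpace ℝ (Fin k)) ∞ Θ (a.source ×ˢ e.source) :=
    ((contMDiffOn_of_mem_maximalAtlas ha).comp contMDiff_fst.contMDiffOn
      fun z hz ↦ hz.1).prodMk_space
    ((contMDiffOn_of_mem_maximalAtlas he).comp contMDiff_snd.contMDiffOn fun z hz ↦ hz.2)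
  have hV₀ : IsOpen (a.source ×ˢ e.source) := a.open_source.prod e.open_source
  have hO₀ : IsOpen (a.target ×ˢ e.target) := a.open_target.prod e.open_target
  have hV : IsOpen (a.source ×ˢ e.source ∩ F ⁻¹' W) := hV₀.inter (hW.preimage hF.continuous)
  have hO : IsOpen (a.target ×ˢ e.target ∩ Ψ ⁻¹' (F ⁻¹' W)) :=
    hΨ.continuousOn.isOpen_inter_preimage hO₀ (hW.preimage hF.continuous)
  have hG : ContDiffOn ℝ ∞ (q ∘ F ∘ Ψ) (a.target ×ˢ e.target ∩ Ψ ⁻¹' (F ⁻¹' W)) := by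
    rw [← contMDiffOn_iff_contDiffOn]
    exact hq.comp (hF.comp_contMDiffOn (hΨ.mono inter_subset_left)) fun z hz ↦ hz.2
  have hΨΘ : ∀ p ∈ a.source ×ˢ e.source, Ψ (Θ p) = p := fun p hp ↦
    Prod.ext (a.left_inv hp.1) (e.left_inv hp.2)
  have hΘO : ∀ p ∈ a.source ×ˢ e.source ∩ F ⁻¹' W,
      Θ p ∈ a.target ×ˢ e.target ∩ Ψ ⁻¹' (F ⁻¹' W) := fun p hp ↦
    ⟨⟨a.map_source hp.1.1, e.map_source hp.1.2⟩, by
      rw [mem_preimage, hΨΘ p hp.1]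
      exact hp.2⟩
  have hqd : ∀ y ∈ W, MDifferentiableAt (𝓡 n) 𝓘(ℝ, C) q y := fun y hy ↦
    ((hq y hy).contMDiffAt (hW.mem_nhds hy)).mdifferentiableAt (by simp)
  refine ⟨A ∩ (a.source ×ˢ e.source ∩ F ⁻¹' W), Filter.inter_mem self_mem_nhdsWithin
    (mem_nhdsWithin_of_mem_nhds
      (hV.mem_nhds ⟨⟨mem_chart_source _ p₀.1, hp₀.1⟩, hyW⟩)), ?_⟩
  have hnull := measure_snd_image_eq_zero (volume : Measure (EuclideanSpace ℝ (Fin k)))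
    (A := Θ '' (A ∩ (a.source ×ˢ e.source ∩ F ⁻¹' W))) hO hG ?_ ?_ ?_ ?_
  · rwa [image_image] at hnull
  · rintro _ ⟨p, hp, rfl⟩
    exact hΘO p hp.2
  · rintro _ ⟨p, ⟨hpA, hp⟩, rfl⟩
    obtain ⟨hy, -⟩ := not_forall.1 hpA.2
    simpa [hΨΘ p hp.1] using (hqS ⟨F p, hy⟩ hp.2).1
  · rintro _ ⟨p, ⟨hpA, hp⟩, rfl⟩
    obtain ⟨hy, -⟩ := not_forall.1 hpA.2
    obtain ⟨-, hr, hk⟩ := hqS ⟨F p, hy⟩ hp.2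
    have hFd : MDifferentiableAt ((𝓡 m).prod (𝓡 k)) (𝓡 n) F p :=
      (hF p).mdifferentiableAt (by simp)
    refine (range_mfderiv_eq_top_iff (g := q ∘ F)
      (((hΨ _ (hΘO p hp).1).contMDiffAt (hO₀.mem_nhds (hΘO p hp).1)).mdifferentiableAt (by simp))
      (((hΘ p hp.1).contMDiffAt (hV₀.mem_nhds hp.1)).mdifferentiableAt (by simp)) ?_
      ((hqd _ hp.2).comp p hFd)).2
      ((isTransverseAt_iff hFd hy (hqd _ hp.2) hr hk).1 (hFS p))
    filter_upwards [hV₀.mem_nhds hp.1] with p' hp' using hΨΘ p' hp'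
  · rintro _ ⟨p, ⟨hpA, hp⟩, rfl⟩ hsurj
    obtain ⟨hy, -⟩ := not_forall.1 hpA.2
    obtain ⟨-, hr, hk⟩ := hqS ⟨F p, hy⟩ hp.2
    have hFt : MDifferentiableAt (𝓡 m) (𝓡 n) (fun x ↦ F (x, p.2)) p.1 :=
      ((hF.comp (contMDiff_id.prodMk contMDiff_const)) p.1).mdifferentiableAt (by simp)
    refine hpA.2 ((isTransverseAt_iff hFt hy (hqd _ hp.2) hr hk).2 ?_)
    have ha' := mdifferentiable_of_mem_maximalAtlas ha
    refine (range_mfderiv_eq_top_iff (Ψ := a.symm) (Θ := a)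
      (ha'.mdifferentiableAt_symm (a.map_source hp.1.1)) (ha'.mdifferentiableAt hp.1.1) ?_
      ((hqd _ hp.2).comp p.1 hFt)).1 ?_
    · filter_upwards [a.open_source.mem_nhds hp.1.1] with x hx using a.left_inv hx
    · have hcongr : (fun u ↦ (q ∘ F ∘ Ψ) (u, (Θ p).2)) = (q ∘ fun x ↦ F (x, p.2)) ∘ a.symm := by
        funext u
        simp [Ψ, Θ, e.left_inv hp.1.2]
      rwa [hcongr] at hsurj
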